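/- A $k$-dimensional vector addition system with states ($k$-VASS) consists of a finite alphabet $\Sigma$, a finite set of states $Q$, an initial configuration $c_0\in Q\times\mathbb N^k$, a finite set $F\subseteq Q\times\mathbb N^k$ of final configurations and a finite transition relation $\delta\subseteq Q\times\Sigma\times\mathbb Z^k\times Q$. A transition $(s,a,v,s')$ reads the letter $a$; it can be fired in the configuration $(q,u)\in Q\times\mathbb N^k$ if $q=s$ and $u+v\ge 0$, and leads to $(s',u+v)$. A configuration $(q,u)$ is accepting if there is $(q,u')\in F$ with $u\ge u'$. The language $L(V)$ of a $k$-VASS $V$ is the set of words read by runs from $c_0$ to an accepting configuration, and its trace language $L_T(V)$ is the language obtained when $F$ is replaced by $Q\times\{0\}$, that is, the set of words read by arbitrary runs from $c_0$. $V$ is deterministic if for each state $q$ and letter $a$ at most one transition over $a$ leaves $q$. $V$ is history-deterministic if there is a resolver, i.e. a function that maps the history of a run (the configurations visited and the transitions taken in them), the current configuration and the next letter to a transition over this letter that can be fired in the current configuration, whenever there is one, such that for each $w\in L(V)$ the run over $w$ from $c_0$ given by the resolver is accepting. Theorem. It is undecidable whether a given deterministic $2$-VASS $A$ and a given history-deterministic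 $2$-VASS $B$ over the same alphabet have equal trace languages, even when the sets of final configurations of $A$ and $B$ are $Q\times\{0\}$ for their respective sets of states $Q$ (so that $L(A)=L_T(A)$ and $L(B)=L_T(B)$). That is, there is no algorithm, even one that need not halt or be correct on other inputs, which for all such $A$ and $B$ halts on every description of $(A,B)$ and answers correctly whether $L_T(A)=L_T(B)$. -/

import Mathlib

/-- A transition of a `k`-dimensional VASS with letters in `α` and states in `Q`:
source state, letter read, effect on the counters, target state. -/
@[ext]
structure VASSTransition (k : ℕ) (α Q : Type) where
  src : Q
  letter : α
  effect : Fin k → ℤ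
  tgt : Q

/-- A configuration: a state together with the values of the `k` non-negative counters. -/
abbrev VASSConfig (k : ℕ) (Q : Type) : Type := Q × (Fin k → ℕ)

/-- A `k`-dimensional vector addition system with states, with alphabet `α` and set of states `Q`
(both are finite types wherever this is used). -/
structure VASS (k : ℕ) (α Q : Type) where
  init : VASSConfig k Q
  final : Finset (VASSConfig k Q)
  trans : Finset (VASSTransition k α Q)

namespace VASS

variable {k : ℕ} {α Q : Type}

/-- Firing `t` in configuration `c` leads to configuration `c'`. Since `c'` has counters in `ℕ`,
this is possible only if no counter becomes negative. -/
def Fires (c : VASSConfig k Q) (t : VASSTransition k α Q) (c' : VASSConfig k Q) : Prop :=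
  c.1 = t.src ∧ c'.1 = t.tgt ∧ ∀ i, (c'.2 i : ℤ) = (c.2 i : ℤ) + t.effect i

/-- `t` is a transition of `V` that can be fired in the configuration `c`. -/
def Enabled (V : VASS k α Q) (c : VASSConfig k Q) (t : VASSTransition k α Q) : Prop :=
  t ∈ V.trans ∧ ∃ c', Fires c t c'

/-- `ρ` is a run of `V` from `c` to `c'`. -/
def IsRun (V : VASS k α Q) :
    VASSConfig k Q → List (VASSTransition k α Q) → VASSConfig k Q → Prop
  | c, [], c' => c' = c
  | c, t :: ρ, c' => t ∈ V.trans ∧ ∃ d, Fires c t d ∧ IsRun V d ρ c'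

/-- The word read by a sequence of transitions. -/
def word (ρ : List (VASSTransition k α Q)) : List α := ρ.map VASSTransition.letter

/-- A configuration is accepting if it covers a final configuration. -/
def Accepting (V : VASS k α Q) (c : VASSConfig k Q) : Prop :=
  ∃ v : Fin k → ℕ, (c.1, v) ∈ V.final ∧ v ≤ c.2

/-- The coverability language: all words read by accepting runs. -/
def language (V : VASS k α Q) : Language α :=
  {w | ∃ ρ c', V.IsRun V.init ρ c' ∧ word ρ = w ∧ V.Accepting c'}

/-- The set of final configurations is `Q × {0}`, so that every configuration is accepting. -/
def HasTraceAcceptance [Fintype Q] (V : VASS k α Q) : Prop :=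
  V.final = Finset.univ ×ˢ {0}

/-- `V` with its set of final configurations replaced by `Q × {0}`. -/
def toTrace [Fintype Q] (V : VASS k α Q) : VASS k α Q :=
  { V with final := Finset.univ ×ˢ {0} }

/-- The trace language of `V`. -/
def traceLanguage [Fintype Q] (V : VASS k α Q) : Language α := V.toTrace.language

/-- For each state and each letter there is at most one transition over this letter that leaves
this state. -/
def IsDeterministic (V : VASS k α Q) : Prop :=
  ∀ t₁ ∈ V.trans, ∀ t₂ ∈ V.trans, t₁.src = t₂.src → t₁.letter = t₂.letter → t₁ = t₂

/-- The type of candidate resolvers: from the history of a run (configurations and transitions taken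
in them), the current configuration and the next letter to a transition, if there is any. -/
abbrev Resolver (k : ℕ) (α Q : Type) : Type :=
  List (VASSConfig k Q × VASSTransition k α Q) → VASSConfig k Q → α →
    Option (VASSTransition k α Q)

/-- `r` is a resolver for `V`: it only returns transitions of `V` over the given letter that can be
fired in the current configuration, and it does return one whenever there is one. -/
def IsResolver (V : VASS k α Q) (r : Resolver k α Q) : Prop :=
  ∀ h c a, (∀ t, r h c a = some t → V.Enabled c t ∧ t.letter = a) ∧
    ((∃ t, V.Enabled c t ∧ t.letter = a) → (r h c a).isSome)

/-- `ρ` leads from `c` to `c'` and, with `h` the history before `c`, each of its transitions is the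
one that `r` returns. -/
def IsResolvedRun (r : Resolver k α Q) :
    List (VASSConfig k Q × VASSTransition k α Q) →
      VASSConfig k Q → List (VASSTransition k α Q) → VASSConfig k Q → Prop
  | _, c, [], c' => c' = c
  | h, c, t :: ρ, c' =>
      r h c t.letter = some t ∧ ∃ d, Fires c t d ∧ IsResolvedRun r (h ++ [(c, t)]) d ρ c'

/-- There is a resolver whose run over each word of the language is accepting. -/
def IsHistoryDeterministic (V : VASS k α Q) : Prop :=
  ∃ r : Resolver k α Q, V.IsResolver r ∧
    ∀ w ∈ V.language, ∃ ρ c', IsResolvedRun r [] V.init ρ c' ∧ word ρ = w ∧ V.Accepting c'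

/-- Finite descriptions of `k`-VASSs, as inputs of algorithms: number of letters, number of states,
initial configuration, list of final configurations, list of transitions. -/
abbrev Code (k : ℕ) : Type :=
  ℕ × ℕ × (ℕ × (Fin k → ℕ)) × List (ℕ × (Fin k → ℕ)) × List (ℕ × ℕ × (Fin k → ℤ) × ℕ)

/-- `e` is a description of `V`: it lists the components of `V`, in any order. -/
def IsCode {m n : ℕ} (e : Code k) (V : VASS k (Fin m) (Fin n)) : Prop :=
  e.1 = m ∧ e.2.1 = n ∧ e.2.2.1 = ((V.init.1 : ℕ), V.init.2) ∧
    (∀ x, x ∈ e.2.2.2.1 ↔ ∃ c ∈ V.final, x = ((c.1 : ℕ), c.2)) ∧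
    (∀ x, x ∈ e.2.2.2.2 ↔
      ∃ t ∈ V.trans, x = ((t.src : ℕ), (t.letter : ℕ), t.effect, (t.tgt : ℕ)))

end VASS

/-! The halting problem reduces to inequality of trace languages, via two-counter machines. For a
counter machine `M`, the deterministic `uncheckedVASS` reads `1` for a decrement, `00` for a zero
branch and `2` on halting. It cannot test for zero, so its only possible error is a zero branch
taken with a positive counter. The `checkingVASS` does the same, but may read `2` only after it has
exposed such an error: at the first `0` it decrements the counter, which is possible only if the
counter is positive, and at the second `0` it restores the counter. A zero branch takes two letters
because the net effect of this check is nil.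

Every word of the checking VASS is a word of the unchecked one (`Represents.reads_unchecked`). If
`M` diverges, an unchecked run can reach a halting state only after an error, and the first error
can be exposed, so the languages agree (`reads_checking_of_not_dom`). If `M` halts, the word of its
true computation followed by `2` separates them (`exists_reads_unchecked_of_dom`). The only
nondeterministic choice is whether to expose an error. Exposing is always best, since afterwards
everything the unchecked VASS can read remains readable; this yields history-determinism
(`checkingVASS_hasBestSuccessors`).

Universality of two counters follows Minsky: a partial recursive function becomes a machine with
four stacks, the stacks become numbers in base 5, these become five counters (one for quotients),
the five counters become one Gödel number, and this becomes two counters. `CollatzMachine` is the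
intermediate model for both conversions of numbers into counters. -/

open Function StateTransition

/-! ### Register machines acting on quotient and remainder -/

/-- A machine with registers indexed by `ι`. An instruction selects a register and replaces its
value `b * q + r` by `m r * q + a r`, where `r < b`, and the next state depends on `r`. -/
structure CollatzMachine (b : ℕ) (ι S : Type*) where
  instr : S → Option (ι × (ℕ → ℕ × ℕ × S))

namespace CollatzMachine

variable {b : ℕ} {ι S : Type*} [DecidableEq ι]

def step (M : CollatzMachine b ι S) (c : S × (ι → ℕ)) : Option (S × (ι → ℕ)) :=
  (M.instr c.1).map fun p =>
    ((p.2 (c.2 p.1 % b)).2.2, update c.2 p.1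
      ((p.2 (c.2 p.1 % b)).1 * (c.2 p.1 / b) + (p.2 (c.2 p.1 % b)).2.1))

/-- A VASS needs finitely many states, whereas the statements of a stack machine form an infinite
type; passing to a finite set closed under the instructions repairs this. The default `s₀` in `ret`
is never reached, by `hT`. -/
theorem exists_restrict (M : CollatzMachine b ι S) (T : Set S)
    (hT : ∀ s ∈ T, ∀ p, M.instr s = some p → ∀ r, (p.2 r).2.2 ∈ T) (s₀ : T) :
    ∃ M' : CollatzMachine b ι T, ∀ u : ι → ℕ,
      (eval M'.step (s₀, u)).Dom ↔ (eval M.step (s₀.1, u)).Dom := by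
  classical
  let ret : S → T := fun s => if h : s ∈ T then ⟨s, h⟩ else s₀
  have hret : ∀ s ∈ T, (ret s : S) = s := fun s h => by simp [ret, h]
  refine ⟨⟨fun s => (M.instr s).map fun p => (p.1, fun r => ((p.2 r).1, (p.2 r).2.1,
    ret (p.2 r).2.2))⟩, fun u => ?_⟩
  refine (tr_eval_dom (tr := fun (c₁ : T × (ι → ℕ)) c₂ => c₂ = ((c₁.1 : S), c₁.2)) ?_ rfl).symm
  rintro ⟨⟨s, hs⟩, u⟩ _ rfl
  cases h : M.instr s with
  | none => simp [step, h]
  | some p =>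
    simp only [step, h, Option.map_some]
    refine ⟨_, rfl, Relation.TransGen.single ?_⟩
    simp only [step, h, Option.map_some, Option.mem_def]
    rw [hret _ (hT s hs p h _)]

end CollatzMachine

/-! ### Counter machines and Gödel numbers -/

/-- An instruction of a counter machine: if the counter `reg` is zero, add `zeroAdd` and go to
`zeroTgt`, otherwise decrement it, add `posAdd` and go to `posTgt`. -/
structure CounterInstr (ι S : Type*) where
  reg : ι
  zeroAdd : ι → ℕ
  zeroTgt : S
  posAdd : ι → ℕ
  posTgt : S
  posAdd_reg : posAdd reg = 0

/-- A counter machine, which halts in the states without an instruction. -/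
structure CounterMachine (ι S : Type*) where
  instr : S → Option (CounterInstr ι S)

namespace CounterMachine

variable {ι S : Type*}

def step [DecidableEq ι] (M : CounterMachine ι S) (c : S × (ι → ℕ)) : Option (S × (ι → ℕ)) :=
  (M.instr c.1).map fun I =>
    if c.2 I.reg = 0 then (I.zeroTgt, c.2 + I.zeroAdd)
    else (I.posTgt, update c.2 I.reg (c.2 I.reg - 1) + I.posAdd)

/-- The Gödel number of a vector of counters. -/
def goedel [Fintype ι] (p : ι → ℕ) (u : ι → ℕ) : ℕ := ∏ i, p i ^ u i

section Goedel

variable [Fintype ι] {p : ι → ℕ}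

theorem goedel_add (u v : ι → ℕ) : goedel p (u + v) = goedel p u * goedel p v := by
  simp [goedel, pow_add, Finset.prod_mul_distrib]

theorem goedel_update_pred [DecidableEq ι] (u : ι → ℕ) (i : ι) (h : u i ≠ 0) :
    goedel p u = p i * goedel p (update u i (u i - 1)) := by
  have hu : u = update u i (u i - 1) + Pi.single i 1 := by
    ext j
    by_cases hj : j = i
    · subst hj; simp; omega
    · simp [hj]
  conv_lhs => rw [hu, goedel_add]
  rw [mul_comm]
  congr 1
  rw [goedel, Finset.prod_eq_single i] <;> simp +contextual

theorem dvd_goedel_iff (hp : ∀ i, (p i).Prime) (hinj : Injective p) (u : ι → ℕ) (i : ι) :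
    p i ∣ goedel p u ↔ u i ≠ 0 := by
  rw [goedel, (hp i).prime.dvd_finsetProd_iff]
  constructor
  · rintro ⟨j, -, hj⟩
    have := hinj ((Nat.prime_dvd_prime_iff_eq (hp i) (hp j)).1 ((hp i).dvd_of_dvd_pow hj))
    subst this
    rintro h
    rw [h, pow_zero, Nat.dvd_one] at hj
    exact (hp i).ne_one hj
  · exact fun h => ⟨i, Finset.mem_univ i, dvd_pow_self _ h⟩

/-- The simulation of a counter machine by a machine with a single register. -/
def toCollatz (M : CounterMachine ι S) (p : ι → ℕ) : CollatzMachine (∏ i, p i) Unit S where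
  instr s := (M.instr s).map fun I => ((), fun r =>
    if p I.reg ∣ r then
      ((∏ i, p i) / p I.reg * goedel p I.posAdd, r / p I.reg * goedel p I.posAdd, I.posTgt)
    else ((∏ i, p i) * goedel p I.zeroAdd, r * goedel p I.zeroAdd, I.zeroTgt))

/-- Let `P` be the product of the primes and `x = P * q + r` the Gödel number. As `p ∣ P`, the prime
`p` divides `x` iff it divides `r`, so the remainder decides the zero test. In that case `x / p = (P
/ p) * q + r / p`, so a decrement, like an addition, is affine in `q`. -/
theorem toCollatz_eval_dom [DecidableEq ι] (M : CounterMachine ι S) (hp : ∀ i, (p i).Prime) (hinj : Injective p)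
    (s : S) (u : ι → ℕ) :
    (eval (M.toCollatz p).step (s, fun _ => goedel p u)).Dom ↔ (eval M.step (s, u)).Dom := by
  refine tr_eval_dom (tr := fun (c₁ : S × (ι → ℕ)) c₂ => c₂ = (c₁.1, fun _ => goedel p c₁.2))
    ?_ rfl
  rintro ⟨s, u⟩ _ rfl
  cases h : M.instr s with
  | none => simp [step, CollatzMachine.step, toCollatz, h]
  | some I =>
    simp only [step, h, Option.map_some]
    refine ⟨_, rfl, Relation.TransGen.single ?_⟩
    have hd : p I.reg ∣ ∏ i, p i := Finset.dvd_prod_of_mem p (Finset.mem_univ I.reg)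
    have hdvd : p I.reg ∣ goedel p u % (∏ i, p i) ↔ u I.reg ≠ 0 := by
      rw [Nat.dvd_mod_iff hd, dvd_goedel_iff hp hinj]
    simp only [CollatzMachine.step, toCollatz, h, Option.map_some, Option.mem_def, hdvd]
    by_cases h0 : u I.reg = 0
    · simp only [h0, ne_eq, not_true_eq_false, if_true, if_false, goedel_add]
      congr 2
      ext x
      simp only [update_self]
      conv_rhs => rw [← Nat.div_add_mod (goedel p u) (∏ i, p i)]
      ring
    · simp only [h0, ne_eq, not_false_eq_true, if_true, if_false, goedel_add]
      congr 2
      ext x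
      simp only [update_apply, if_true]
      have h1 := goedel_update_pred (p := p) u I.reg h0
      obtain ⟨B, hB⟩ := hd
      obtain ⟨r, hr⟩ := hdvd.2 h0
      have hpos := (hp I.reg).pos
      have h2 := Nat.div_add_mod (goedel p u) (∏ i, p i)
      have h3 : goedel p (update u I.reg (u I.reg - 1)) = B * (goedel p u / ∏ i, p i) + r := by
        apply Nat.eq_of_mul_eq_mul_left hpos
        rw [← h1, ← h2, hr]
        conv_rhs => rw [← hr, h2]
        rw [mul_add, ← mul_assoc, ← hB]
      rw [h3, hr, Nat.mul_div_cancel_left _ hpos]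
      conv_lhs => enter [1, 1, 1]; rw [hB, Nat.mul_div_cancel_left _ hpos]
      ring

end Goedel

end CounterMachine

/-! ### Registers simulated by counters, with one extra counter -/

namespace CollatzMachine

variable {b : ℕ} [NeZero b] {ι S J : Type*} [DecidableEq J]

/-- The simulation of a machine with registers `ι` by a counter machine with counters `J`. The
counter `t` is used to store quotients. The states `(s, false, j)` divide the register by `b`,
having seen the remainder `j` so far, and the states `(s, true, j)` multiply the quotient. -/
def toCounter (M : CollatzMachine b ι S) (f : ι → J) (t : J) (hf : ∀ i, f i ≠ t) :
    CounterMachine J (S × Bool × Fin b) where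
  instr
    | (s, false, j) => (M.instr s).map fun p =>
      { reg := f p.1
        zeroAdd := 0
        zeroTgt := (s, true, j)
        posAdd := if j.val + 1 < b then 0 else Pi.single t 1
        posTgt := (s, false, if h : j.val + 1 < b then ⟨j.val + 1, h⟩ else 0)
        posAdd_reg := by split_ifs <;> simp [hf] }
    | (s, true, j) => (M.instr s).map fun p =>
      { reg := t
        zeroAdd := Pi.single (f p.1) (p.2 j).2.1
        zeroTgt := ((p.2 j).2.2, false, 0)
        posAdd := Pi.single (f p.1) (p.2 j).1
        posTgt := (s, true, j)
        posAdd_reg := by simp [(hf _).symm] }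

variable {M : CollatzMachine b ι S} {f : ι → J} {t : J} {hf : ∀ i, f i ≠ t}

/-- Each decrement of the register advances the remainder cyclically, and each wraparound adds one
to `t`. The induction on the register needs an arbitrary starting remainder `j`, whence `x + j`. -/
theorem toCounter_divide {s : S} {p} (hp : M.instr s = some p) (x : ℕ) (j : Fin b) (u : J → ℕ)
    (hx : u (f p.1) = x) :
    Reaches (M.toCounter f t hf).step ((s, false, j), u)
      ((s, true, Fin.ofNat b (x + j)),
        update (update u (f p.1) 0) t (u t + (x + j) / b)) := by
  induction x generalizing j u with
  | zero =>
    apply Relation.ReflTransGen.single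
    simp only [CounterMachine.step, toCounter, hp, Option.map_some, hx, if_true, Option.mem_def]
    refine congrArg some (Prod.ext ?_ ?_)
    · simp
    · ext k
      dsimp only
      by_cases hk : k = t
      · subst hk; simp [Nat.div_eq_of_lt j.2]
      · by_cases hk' : k = f p.1
        · subst hk'; simp [hf, hx]
        · simp [hk, hk']
  | succ x ih =>
    have hs : (M.toCounter f t hf).step ((s, false, j), u) =
        some ((s, false, if h : j.val + 1 < b then ⟨j.val + 1, h⟩ else 0),
          update u (f p.1) x + if j.val + 1 < b then 0 else Pi.single t 1) := by
      simp [CounterMachine.step, toCounter, hp, hx]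
    refine Relation.ReflTransGen.head hs ?_
    have hb : 0 < b := Nat.pos_of_ne_zero (NeZero.ne b)
    split_ifs with h
    · have hj : x + 1 + j.val = x + (j.val + 1) := by omega
      refine (congrArg₂ (Reaches _) ?_ ?_).mp (ih ⟨j.val + 1, h⟩ (update u (f p.1) x) (by simp))
      · rw [add_zero]
      · simp [(hf _).symm, hj]
    -- The wraparound: the remainder restarts at `0`, and the lost `b` is accounted for by the unit
    -- added to `t`.
    · have hj : j.val + 1 = b := by omega
      have this : x + 1 + j.val = x + b := by omega
      refine (congrArg (Reaches _ _) (Prod.ext ?_ ?_)).mp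
        (ih 0 (update u (f p.1) x + Pi.single t 1) (by simp [hf]))
      · simp [this, Fin.ext_iff]
      · ext k
        dsimp only
        by_cases hk : k = t
        · subst hk; simp [this, (hf _).symm, Nat.add_div_right _ hb]; ring
        · by_cases hk' : k = f p.1
          · subst hk'; simp [hf]
          · simp [hk, hk']

/-- Each unit of `t` is exchanged for the multiplier, and the constant is added once, at the final
zero test. That test guarantees at least one step, which the preservation of divergence requires. -/
theorem toCounter_multiply {s : S} {p} (hp : M.instr s = some p) (y : ℕ) (j : Fin b) (u : J → ℕ)
    (hy : u t = y) :
    Reaches₁ (M.toCounter f t hf).step ((s, true, j), u)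
      (((p.2 j).2.2, false, 0),
        update (update u t 0) (f p.1) ((p.2 j).1 * y + u (f p.1) + (p.2 j).2.1)) := by
  induction y generalizing u with
  | zero =>
    apply Relation.TransGen.single
    simp only [CounterMachine.step, toCounter, hp, Option.map_some, hy, if_true, Option.mem_def]
    congr 2
    ext k
    by_cases hk : k = f p.1
    · subst hk; simp
    · by_cases hk' : k = t
      · subst hk'; simp [hk, hy]
      · simp [hk, hk']
  | succ y ih =>
    have hs : (M.toCounter f t hf).step ((s, true, j), u) =
        some ((s, true, j), update u t y + Pi.single (f p.1) (p.2 j).1) := by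
      simp [CounterMachine.step, toCounter, hp, hy]
    refine Relation.TransGen.head hs ?_
    have := ih (update u t y + Pi.single (f p.1) (p.2 j).1) (by simp [(hf _).symm])
    refine (congrArg (fun v => Reaches₁ (M.toCounter f t hf).step
      ((s, true, j), update u t y + Pi.single (f p.1) (p.2 j).1)
      (((p.2 j).2.2, false, 0), v)) ?_).mp this
    ext k
    by_cases hk : k = f p.1
    · subst hk; simp [hf]; ring
    · by_cases hk' : k = t
      · subst hk'; simp [hk]
      · simp [hk, hk']

theorem toCounter_eval_dom [DecidableEq ι] (M : CollatzMachine b ι S) (hinj : Injective f) (s : S) (u : J → ℕ)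
    (hu : u t = 0) :
    (eval (M.toCounter f t hf).step ((s, false, 0), u)).Dom ↔ (eval M.step (s, u ∘ f)).Dom := by
  refine tr_eval_dom (tr := fun (c₁ : S × (ι → ℕ)) c₂ =>
    c₂.1 = (c₁.1, false, 0) ∧ c₂.2 t = 0 ∧ c₁.2 = c₂.2 ∘ f) ?_ ⟨rfl, hu, rfl⟩
  rintro ⟨s, v⟩ ⟨s', u⟩ ⟨h₁, hu, h₂⟩
  dsimp only at h₁ hu h₂
  subst h₁ h₂
  cases h : M.instr s with
  | none => simp [step, CounterMachine.step, toCounter, h]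
  | some p =>
    simp only [step, h, Option.map_some]
    refine ⟨_, ?_, Relation.TransGen.trans_right (toCounter_divide h _ 0 u rfl)
      (toCounter_multiply h _ _ _ rfl)⟩
    refine ⟨?_, ?_, ?_⟩
    · simp
    · simp [(hf _).symm]
    · ext k
      by_cases hk : k = p.1
      · subst hk; simp [hf, hu]
      · simp [hk, hinj.ne hk, hf]

end CollatzMachine

/-! ### Stacks as numbers in base `b` -/

namespace CollatzMachine

/-- The number whose base `b` digits are the codes of the elements of a stack. -/
def stackNum {G : Type*} (b : ℕ) (enc : G → ℕ) : List G → ℕ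
  | [] => 0
  | g :: l => enc g + b * stackNum b enc l

section Stack

variable {G : Type*} {b : ℕ} {enc : G → ℕ} {dec : ℕ → Option G}

theorem stackNum_div (hb : ∀ g, enc g < b) (l : List G) :
    stackNum b enc l / b = stackNum b enc l.tail := by
  cases l with
  | nil => simp [stackNum]
  | cons g l =>
    have := hb g
    rw [stackNum, Nat.add_mul_div_left _ _ (by omega), Nat.div_eq_of_lt this, zero_add]
    rfl

/-- By `h0` and `hdec` the digit `0` encodes no symbol, so remainder `0` occurs exactly for the
empty stack. -/
theorem dec_stackNum_mod (hb : ∀ g, enc g < b) (h0 : dec 0 = none)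
    (hdec : ∀ g, dec (enc g) = some g) (l : List G) :
    dec (stackNum b enc l % b) = l.head? := by
  cases l with
  | nil => simp [stackNum, h0]
  | cons g l => simp [stackNum, Nat.mod_eq_of_lt (hb g), hdec]

end Stack

open Turing TM2 in
/-- The simulation of a machine with stacks by a machine with registers. -/
def ofTM2 {K G Λ σ : Type*} [Inhabited K] (b : ℕ) (enc : G → ℕ) (dec : ℕ → Option G)
    (M : Λ → Stmt (fun _ : K => G) Λ σ) :
    CollatzMachine b K (Option (Stmt (fun _ : K => G) Λ σ) × σ) where
  instr
    | (none, _) => none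
    | (some (Stmt.push k f q), v) => some (k, fun r => (b * b, b * r + enc (f v), some q, v))
    | (some (Stmt.peek k f q), v) => some (k, fun r => (b, r, some q, f v (dec r)))
    | (some (Stmt.pop k f q), v) => some (k, fun r => (1, 0, some q, f v (dec r)))
    | (some (Stmt.load f q), v) => some (default, fun r => (b, r, some q, f v))
    | (some (Stmt.branch f q₁ q₂), v) =>
        some (default, fun r => (b, r, some (bif f v then q₁ else q₂), v))
    | (some (Stmt.goto l), v) => some (default, fun r => (b, r, some (M (l v)), v))
    | (some Stmt.halt, v) => some (default, fun r => (b, r, none, v))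

section TM2

open Turing TM2

variable {K G Λ σ : Type} [Inhabited K] {b : ℕ} {enc : G → ℕ}
  {dec : ℕ → Option G} {M : Λ → Stmt (fun _ : K => G) Λ σ}

/-- This is the closure property for `exists_restrict`: an instruction passes to a substatement, to
the body of a label in `S`, or halts. -/
theorem ofTM2_mem_stmts [Inhabited Λ] {S : Finset Λ} (hM : Supports M S)
    (s : Option (Stmt (fun _ : K => G) Λ σ) × σ) (hs : s.1 ∈ stmts M S)
    (p) (hp : (ofTM2 b enc dec M).instr s = some p) (r : ℕ) : (p.2 r).2.2.1 ∈ stmts M S := by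
  obtain ⟨q, v⟩ := s
  have trans : ∀ q₁ q₂, q₁ ∈ stmts₁ q₂ → some q₂ ∈ stmts M S → some q₁ ∈ stmts M S :=
    fun _ _ => stmts_trans
  cases q with
  | none => simp [ofTM2] at hp
  | some q =>
    have hsup := stmts_supportsStmt hM hs
    have hs' := fun q₁ h => trans q₁ q h hs
    cases q with
    | goto l =>
      obtain rfl := Option.some.inj hp
      simp only [stmts, Finset.some_mem_insertNone, Finset.mem_biUnion]
      exact ⟨_, hsup v, stmts₁_self⟩
    | halt =>
      obtain rfl := Option.some.inj hp
      simp [stmts]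
    | branch f q₁ q₂ =>
      obtain rfl := Option.some.inj hp
      refine hs' _ ?_
      cases f v <;> simp [stmts₁, stmts₁_self]
    | _ =>
      obtain rfl := Option.some.inj hp
      exact hs' _ (by simp [stmts₁, stmts₁_self])

variable [DecidableEq K]

/-- One step of the stack machine executes a whole statement, hence the induction on `q`. A push
appends a lowest digit, a pop keeps only the quotient, and every other constructor reassembles `b *
(x / b) + x % b = x`. -/
theorem ofTM2_stepAux (hb : ∀ g, enc g < b) (h0 : dec 0 = none)
    (hdec : ∀ g, dec (enc g) = some g) (q : Stmt (fun _ : K => G) Λ σ) (v : σ) (u : K → List G) :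
    Reaches₁ (ofTM2 b enc dec M).step ((some q, v), fun k => stackNum b enc (u k))
      (((stepAux q v u).l.map M, (stepAux q v u).var),
        fun k => stackNum b enc ((stepAux q v u).stk k)) := by
  have hnop : ∀ x, b * (x / b) + x % b = x := fun x => Nat.div_add_mod x b
  have hupd : ∀ (u : K → List G) (k : K) (l : List G), (fun k' => stackNum b enc (update u k l k')) =
      update (fun k' => stackNum b enc (u k')) k (stackNum b enc l) := fun u k l => by
    ext k'
    by_cases h : k' = k
    · subst h; simp
    · simp [h]
  induction q generalizing v u with
  | push k f q ih =>
    refine Relation.TransGen.head ?_ (ih v (update u k (f v :: u k)))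
    simp only [step, ofTM2, Option.map_some, Option.mem_def, hupd, stackNum]
    congr 3
    conv_rhs => rw [← hnop (stackNum b enc (u k))]
    ring
  | peek k f q ih =>
    refine Relation.TransGen.head ?_ (ih (f v (u k).head?) u)
    simp [step, ofTM2, hnop, dec_stackNum_mod hb h0 hdec]
  | pop k f q ih =>
    refine Relation.TransGen.head ?_ (ih (f v (u k).head?) (update u k (u k).tail))
    simp [step, ofTM2, dec_stackNum_mod hb h0 hdec, hupd, stackNum_div hb]
  | load f q ih =>
    refine Relation.TransGen.head ?_ (ih (f v) u)
    simp [step, ofTM2, hnop]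
  | branch f q₁ q₂ ih₁ ih₂ =>
    cases h : f v with
    | true =>
      rw [stepAux, h]
      refine Relation.TransGen.head ?_ (ih₁ v u)
      simp [step, ofTM2, hnop, h]
    | false =>
      rw [stepAux, h]
      refine Relation.TransGen.head ?_ (ih₂ v u)
      simp [step, ofTM2, hnop, h]
  | goto l =>
    apply Relation.TransGen.single
    simp [step, ofTM2, hnop]
  | halt =>
    apply Relation.TransGen.single
    simp [step, ofTM2, hnop]

theorem ofTM2_eval_dom (hb : ∀ g, enc g < b) (h0 : dec 0 = none)
    (hdec : ∀ g, dec (enc g) = some g) (l : Option Λ) (v : σ) (u : K → List G) :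
    (eval (ofTM2 b enc dec M).step ((l.map M, v), fun k => stackNum b enc (u k))).Dom ↔
      (eval (TM2.step M) ⟨l, v, u⟩).Dom := by
  refine tr_eval_dom (tr := fun (c₁ : Cfg (fun _ : K => G) Λ σ) c₂ =>
    c₂ = ((c₁.l.map M, c₁.var), fun k => stackNum b enc (c₁.stk k))) ?_ rfl
  rintro ⟨l, v, u⟩ _ rfl
  cases l with
  | none => simp [step, ofTM2]
  | some l => exact ⟨_, rfl, ofTM2_stepAux hb h0 hdec (M l) v u⟩

theorem exists_of_tm2 [Inhabited Λ] [Finite σ] {S : Finset Λ} (hM : Supports M S)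
    (hb : ∀ g, enc g < b) (h0 : dec 0 = none) (hdec : ∀ g, dec (enc g) = some g) (l : Λ)
    (hl : l ∈ S) (v : σ) :
    ∃ (T : Type) (_ : Finite T) (M' : CollatzMachine b K T) (s : T), ∀ u : K → List G,
      (eval M'.step (s, fun k => stackNum b enc (u k))).Dom ↔
        (eval (TM2.step M) ⟨some l, v, u⟩).Dom := by
  have hmem : (some (M l), v) ∈ (↑(stmts M S) ×ˢ Set.univ : Set (_ × σ)) := by
    simp only [Set.mem_prod, Set.mem_univ, and_true, Finset.mem_coe, stmts,
      Finset.some_mem_insertNone, Finset.mem_biUnion]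
    exact ⟨l, hl, stmts₁_self⟩
  obtain ⟨M', h⟩ := (ofTM2 b enc dec M).exists_restrict (↑(stmts M S) ×ˢ Set.univ)
    (fun s hs p hp r => ⟨ofTM2_mem_stmts hM s hs.1 p hp r, trivial⟩) ⟨_, hmem⟩
  refine ⟨_, ((stmts M S).finite_toSet.prod Set.finite_univ).to_subtype, M', ⟨_, hmem⟩, fun u => ?_⟩
  rw [h, ← ofTM2_eval_dom hb h0 hdec]
  rfl

end TM2

end CollatzMachine

/-! ### Computability of the encoded input -/

section Input

open Turing PartrecToTM2

/-- The codes of the stack symbols as base `5` digits. -/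
def stackDigit : Γ' → ℕ
  | Γ'.consₗ => 1
  | Γ'.cons => 2
  | Γ'.bit0 => 3
  | Γ'.bit1 => 4

def stackSymbol : ℕ → Option Γ'
  | 1 => some Γ'.consₗ
  | 2 => some Γ'.cons
  | 3 => some Γ'.bit0
  | 4 => some Γ'.bit1
  | _ => none

theorem stackDigit_lt (g : Γ') : stackDigit g < 5 := by cases g <;> simp [stackDigit]

theorem stackSymbol_stackDigit (g : Γ') : stackSymbol (stackDigit g) = some g := by cases g <;> rfl

theorem trNat_posNum (p : PosNum) : trNat (p : ℕ) = trPosNum p := by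
  have : ((p : ℕ) : Num) = Num.pos p := by
    rw [← Num.cast_pos, Num.of_to_nat]
  rw [trNat, this, trNum]

/-- Numbers are stored in binary with the lowest bit on top; this recursion on `n / 2` is what makes
the encoding visibly primitive recursive. -/
theorem trNat_of_ne_zero {n : ℕ} (hn : n ≠ 0) :
    trNat n = (if n % 2 = 0 then Γ'.bit0 else Γ'.bit1) :: trNat (n / 2) := by
  obtain ⟨p, rfl⟩ : ∃ p : PosNum, (p : ℕ) = n := by
    have h := Num.to_of_nat n
    cases hN : (n : Num) with
    | zero => rw [hN] at h; exact absurd h.symm hn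
    | pos p => exact ⟨p, by rw [hN] at h; exact h⟩
  rw [trNat_posNum]
  cases p with
  | one => simp [trPosNum]
  | bit0 p =>
    have h : ((PosNum.bit0 p : PosNum) : ℕ) = p + p := by simp
    have h2 : ((p : ℕ) + p) / 2 = p := by omega
    have h3 : ((p : ℕ) + p) % 2 = 0 := by omega
    rw [h, h2, h3, trNat_posNum, trPosNum]; rfl
  | bit1 p =>
    have h : ((PosNum.bit1 p : PosNum) : ℕ) = p + p + 1 := by simp
    have h2 : ((p : ℕ) + p + 1) / 2 = p := by omega
    have h3 : ((p : ℕ) + p + 1) % 2 = 1 := by omega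
    rw [h, h2, h3, trNat_posNum, trPosNum]; rfl

theorem stackNum_trList_zero : CollatzMachine.stackNum 5 stackDigit (trList [0]) = 2 := by
  simp [CollatzMachine.stackNum, stackDigit]

theorem stackNum_trList {n : ℕ} (hn : n ≠ 0) :
    CollatzMachine.stackNum 5 stackDigit (trList [n]) =
      3 + n % 2 + 5 * CollatzMachine.stackNum 5 stackDigit (trList [n / 2]) := by
  rw [trList, trNat_of_ne_zero hn, List.cons_append, CollatzMachine.stackNum]
  rcases Nat.mod_two_eq_zero_or_one n with h | h <;> simp [h, stackDigit]

theorem primrec_stackNum_trList :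
    Primrec fun n => CollatzMachine.stackNum 5 stackDigit (trList [n]) := by
  -- In the course-of-values recursion `l` lists the values at all arguments below `n`, so
  -- `l.length` is `n`. The value `2` at `n = 0` is the digit of the separator `Γ'.cons` alone.
  have hg : Primrec₂ fun (_ : Unit) (l : List ℕ) =>
      some (if l.length = 0 then 2 else 3 + l.length % 2 + 5 * l.getD (l.length / 2) 0) := by
    have hl : Primrec fun x : Unit × List ℕ => x.2.length := Primrec.list_length.comp Primrec.snd
    refine Primrec.option_some.comp (Primrec.ite (Primrec.eq.comp hl (Primrec.const 0))
      (Primrec.const 2) ?_)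
    exact Primrec.nat_add.comp
      (Primrec.nat_add.comp (Primrec.const 3) (Primrec.nat_mod.comp hl (Primrec.const 2)))
      (Primrec.nat_mul.comp (Primrec.const 5) ((Primrec.list_getD 0).comp Primrec.snd
        (Primrec.nat_div.comp hl (Primrec.const 2))))
  refine (Primrec.nat_strong_rec
    (fun (_ : Unit) n => CollatzMachine.stackNum 5 stackDigit (trList [n])) hg
    (fun _ n => ?_)).comp (Primrec.const ()) Primrec.id
  by_cases hn : n = 0
  · subst hn
    simp [stackNum_trList_zero, -trList]
  · have : n / 2 < n := by omega
    rw [stackNum_trList hn]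
    simp [hn, List.getD_eq_getElem?_getD, this, -trList]

theorem primrec_const_pow (m : ℕ) : Primrec fun n : ℕ => m ^ n := by
  refine (Primrec.nat_rec₁ 1 (f := fun _ x => x * m)
    (Primrec.nat_mul.comp Primrec.snd (Primrec.const m))).of_eq fun n => ?_
  induction n with
  | zero => rfl
  | succ n ih => rw [pow_succ, ← ih]

end Input

/-! ### Universality of two-counter machines -/

section Universality

open Turing PartrecToTM2

instance : Fintype K' := ⟨{K'.main, K'.rev, K'.aux, K'.stack}, fun k => by cases k <;> simp⟩

/-- The prime that represents a counter in Gödel numbers. -/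
def counterPrime : Option K' → ℕ
  | none => 2
  | some K'.main => 3
  | some K'.rev => 5
  | some K'.aux => 7
  | some K'.stack => 11

theorem counterPrime_prime : ∀ i, (counterPrime i).Prime
  | none | some K'.main | some K'.rev | some K'.aux | some K'.stack => by norm_num [counterPrime]

theorem counterPrime_injective : Injective counterPrime := by
  rintro (_ | _ | _) (_ | _ | _) h <;> simp_all [counterPrime]

theorem goedel_main (x : ℕ) :
    CounterMachine.goedel counterPrime (fun o => o.elim 0 (Pi.single K'.main x)) = 3 ^ x := by
  rw [CounterMachine.goedel, Finset.prod_eq_single (some K'.main)]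
  · simp [counterPrime]
  · rintro (_ | k) - hk
    · simp
    · have : k ≠ K'.main := fun h => hk (by rw [h])
      simp [this]
  · simp

theorem exists_stackMachine_eval_dom {f : ℕ →. ℕ} (hf : Partrec f) :
    ∃ (T : Type) (_ : Finite T) (M : CollatzMachine 5 K' T) (s : T), ∀ n,
      (eval M.step (s, Pi.single K'.main
        (CollatzMachine.stackNum 5 stackDigit (trList [n])))).Dom ↔ (f n).Dom := by
  obtain ⟨c, hc⟩ := ToPartrec.Code.exists_code
    (Nat.Partrec'.of_part (f := fun v : List.Vector ℕ 1 => f v.head)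
      (hf.comp Computable.vector_head))
  let k := Cont'.halt
  obtain ⟨T, hT, M, s, h⟩ := @CollatzMachine.exists_of_tm2 K' Γ' Λ' (Option Γ') _ 5 stackDigit
    stackSymbol tr _ ⟨trNormal c k⟩ _ _ (tr_supports c k) stackDigit_lt rfl
    stackSymbol_stackDigit (trNormal c k) (codeSupp_self c k (trStmts₁_self _)) none
  refine ⟨T, hT, M, s, fun n => ?_⟩
  have h1 := h (K'.elim (trList [n]) [] [] [])
  have h2 : (fun j => CollatzMachine.stackNum 5 stackDigit (K'.elim (trList [n]) [] [] [] j)) =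
      Pi.single K'.main (CollatzMachine.stackNum 5 stackDigit (trList [n])) := by
    ext j
    cases j <;> simp [K'.elim, CollatzMachine.stackNum, -trList]
  rw [h2] at h1
  rw [h1]
  have h3 := congrArg Part.Dom (tr_eval c [n])
  have h4 := congrArg Part.Dom (hc ⟨[n], rfl⟩)
  refine (iff_of_eq h3).trans ((iff_of_eq h4).trans ?_)
  rfl

/-- Counter machines with two counters are universal. -/
theorem exists_counterMachine_eval_dom {f : ℕ →. ℕ} (hf : Partrec f) :
    ∃ (S : Type) (_ : Finite S) (M : CounterMachine (Fin 2) S) (s : S) (g : ℕ → ℕ),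
      Primrec g ∧ ∀ n, (eval M.step (s, ![g n, 0])).Dom ↔ (f n).Dom := by
  obtain ⟨T, hT, M, s, h⟩ := exists_stackMachine_eval_dom hf
  let M₂ := M.toCounter some none (fun _ => Option.some_ne_none _)
  let M₃ := M₂.toCollatz counterPrime
  have : NeZero (∏ i, counterPrime i) :=
    ⟨Finset.prod_ne_zero_iff.2 fun i _ => (counterPrime_prime i).ne_zero⟩
  let M₄ := M₃.toCounter (fun _ => (0 : Fin 2)) 1 (fun _ => by simp)
  -- The input stack is the only nonzero counter of `M₂`, and its prime is `3`, so the initial Gödel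
  -- number is a power of `3`.
  refine ⟨_, inferInstance, M₄, ((s, false, 0), false, 0), _,
    (primrec_const_pow 3).comp primrec_stackNum_trList, fun n => ?_⟩
  rw [← h n]
  refine (CollatzMachine.toCounter_eval_dom M₃ (injective_of_subsingleton _) _ _ (by simp)).trans ?_
  have h1 := M₂.toCollatz_eval_dom counterPrime_prime counterPrime_injective (s, false, 0)
    (fun o => o.elim 0
      (Pi.single K'.main (CollatzMachine.stackNum 5 stackDigit (trList [n]))))
  rw [goedel_main] at h1
  refine Iff.trans (iff_of_eq ?_) (h1.trans ?_)
  · rfl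
  · exact CollatzMachine.toCounter_eval_dom M (Option.some_injective _) s _ rfl

end Universality

/-! ### Readable words, history-determinism and renaming of states -/

namespace VASS

variable {k : ℕ} {α Q R : Type}

/-- Some transition over `a` leads from `c` to `c'`. -/
def Step (V : VASS k α Q) (c : VASSConfig k Q) (a : α) (c' : VASSConfig k Q) : Prop :=
  ∃ t ∈ V.trans, t.letter = a ∧ Fires c t c'

/-- The word `w` can be read from the configuration `c`. -/
def Reads (V : VASS k α Q) : VASSConfig k Q → List α → Prop
  | _, [] => True
  | c, a :: w => ∃ c', V.Step c a c' ∧ Reads V c' w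

theorem reads_iff_exists_isRun {V : VASS k α Q} {c : VASSConfig k Q} {w : List α} :
    V.Reads c w ↔ ∃ ρ c', V.IsRun c ρ c' ∧ word ρ = w := by
  induction w generalizing c with
  | nil => exact ⟨fun _ => ⟨[], c, rfl, rfl⟩, fun _ => trivial⟩
  | cons a w ih =>
    constructor
    · rintro ⟨d, ⟨t, ht, rfl, hf⟩, hw⟩
      obtain ⟨ρ, c', hρ, rfl⟩ := ih.1 hw
      exact ⟨t :: ρ, c', ⟨ht, d, hf, hρ⟩, rfl⟩
    · rintro ⟨_ | ⟨t, ρ⟩, c', hρ, hw⟩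
      · simp [word] at hw
      · obtain ⟨ht, d, hf, hρ⟩ := hρ
        obtain ⟨rfl, hw'⟩ := List.cons.inj hw
        exact ⟨d, ⟨t, ht, rfl, hf⟩, ih.2 ⟨ρ, c', hρ, hw'⟩⟩

theorem Fires.unique {c d d' : VASSConfig k Q} {t : VASSTransition k α Q} (h : Fires c t d)
    (h' : Fires c t d') : d = d' := by
  refine Prod.ext (h.2.1.trans h'.2.1.symm) (funext fun i => ?_)
  have h1 := h.2.2 i
  have h2 := h'.2.2 i
  omega

theorem HasTraceAcceptance.accepting [Fintype Q] {V : VASS k α Q} (h : V.HasTraceAcceptance)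
    (c : VASSConfig k Q) : V.Accepting c :=
  ⟨0, by rw [h]; simp, fun _ => Nat.zero_le _⟩

theorem HasTraceAcceptance.mem_language [Fintype Q] {V : VASS k α Q} (h : V.HasTraceAcceptance)
    {w : List α} : w ∈ V.language ↔ V.Reads V.init w := by
  rw [reads_iff_exists_isRun]
  exact ⟨fun ⟨ρ, c', hρ, hw, _⟩ => ⟨ρ, c', hρ, hw⟩,
    fun ⟨ρ, c', hρ, hw⟩ => ⟨ρ, c', hρ, hw, h.accepting c'⟩⟩

theorem HasTraceAcceptance.mem_traceLanguage [Fintype Q] {V : VASS k α Q}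
    (h : V.HasTraceAcceptance) {w : List α} : w ∈ V.traceLanguage ↔ V.Reads V.init w := by
  have : V.toTrace = V := by
    cases V
    simp only [toTrace, HasTraceAcceptance] at h ⊢
    rw [h]
  rw [traceLanguage, this, h.mem_language]

/-- In each configuration and for each letter there is a best successor, one from which all words
can be read that can be read from any of them. -/
def HasBestSuccessors (V : VASS k α Q) : Prop :=
  ∀ c a, (∃ d, V.Step c a d) →
    ∃ d, V.Step c a d ∧ ∀ d', V.Step c a d' → ∀ w, V.Reads d' w → V.Reads d w


/-- The resolver ignores the history and always moves to a best successor. The rest of the word then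
stays readable, and every configuration is accepting. -/
theorem HasTraceAcceptance.isHistoryDeterministic [Fintype Q] {V : VASS k α Q}
    (hV : V.HasTraceAcceptance)
    (h : V.HasBestSuccessors) : V.IsHistoryDeterministic := by
  classical
  have key : ∀ c a, ∃ o : Option (VASSTransition k α Q),
      (∀ t, o = some t → V.Enabled c t ∧ t.letter = a ∧
        ∀ d, Fires c t d → ∀ d', V.Step c a d' → ∀ w, V.Reads d' w → V.Reads d w) ∧
      ((∃ t, V.Enabled c t ∧ t.letter = a) → o.isSome) := by
    intro c a
    by_cases hc : ∃ d, V.Step c a d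
    · obtain ⟨d, ⟨t, ht, hta, hf⟩, hd⟩ := h c a hc
      refine ⟨some t, fun t' ht' => ?_, fun _ => rfl⟩
      obtain rfl := Option.some.inj ht'
      exact ⟨⟨ht, d, hf⟩, hta, fun d₁ hd₁ => hd₁.unique hf ▸ hd⟩
    · exact ⟨none, by simp, fun ⟨t, ⟨ht, d, hf⟩, hta⟩ => (hc ⟨d, t, ht, hta, hf⟩).elim⟩
  choose r hr hr' using key
  refine ⟨fun _ c a => r c a,
    fun _ c a => ⟨fun t ht => ⟨(hr c a t ht).1, (hr c a t ht).2.1⟩, hr' c a⟩, fun w hw => ?_⟩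
  rw [hV.mem_language] at hw
  suffices H : ∀ (w : List α) hist c, V.Reads c w → ∃ ρ c',
      IsResolvedRun (fun _ c a => r c a) hist c ρ c' ∧ word ρ = w by
    obtain ⟨ρ, c', h1, h2⟩ := H w [] V.init hw
    exact ⟨ρ, c', h1, h2, hV.accepting c'⟩
  intro w
  induction w with
  | nil => exact fun _ c _ => ⟨[], c, rfl, rfl⟩
  | cons a w ih =>
    rintro hist c ⟨d', hs, hw⟩
    obtain ⟨t₀, ht₀, ht₀a, hf₀⟩ := id hs
    obtain ⟨t, ht⟩ := Option.isSome_iff_exists.1 (hr' c a ⟨t₀, ⟨ht₀, d', hf₀⟩, ht₀a⟩)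
    obtain ⟨⟨_, d, hf⟩, rfl, hdom⟩ := hr c a t ht
    obtain ⟨ρ, c', hρ, rfl⟩ := ih (hist ++ [(c, t)]) d (hdom d hf d' hs w hw)
    exact ⟨t :: ρ, c', ⟨ht, d, hf, hρ⟩, rfl⟩

/-- A simulation between configurations of two VASSs. -/
theorem Reads.of_simulation {V : VASS k α Q} {W : VASS k α R}
    (rel : VASSConfig k Q → VASSConfig k R → Prop)
    (h : ∀ c d a c', rel c d → V.Step c a c' → ∃ d', W.Step d a d' ∧ rel c' d')
    {c : VASSConfig k Q} {d : VASSConfig k R} (hcd : rel c d) {w : List α} (hw : V.Reads c w) :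
    W.Reads d w := by
  induction w generalizing c d with
  | nil => trivial
  | cons a w ih =>
    obtain ⟨c', hs, hw⟩ := hw
    obtain ⟨d', hd, hr⟩ := h c d a c' hcd hs
    exact ⟨d', hd, ih hr hw⟩

/-- The VASS with the states renamed. -/
def rename (e : Q ≃ R) (V : VASS k α Q) : VASS k α R where
  init := (e V.init.1, V.init.2)
  final := V.final.map (e.toEmbedding.prodMap (Function.Embedding.refl _))
  trans := V.trans.map ⟨fun t => ⟨e t.src, t.letter, t.effect, e t.tgt⟩, fun t t' h => by
    simp only [VASSTransition.mk.injEq, EmbeddingLike.apply_eq_iff_eq] at h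
    exact VASSTransition.ext h.1 h.2.1 h.2.2.1 h.2.2.2⟩

section Rename

variable {e : Q ≃ R} {V : VASS k α Q}

theorem HasTraceAcceptance.rename [Fintype Q] [Fintype R] (h : V.HasTraceAcceptance) :
    (V.rename e).HasTraceAcceptance := by
  unfold HasTraceAcceptance at h ⊢
  ext ⟨q, u⟩
  simp [VASS.rename, h, Prod.ext_iff, eq_comm]
  exact fun _ => ⟨e.symm q, by simp⟩

theorem rename_step {c c' : VASSConfig k Q} {a : α} :
    (V.rename e).Step (e c.1, c.2) a (e c'.1, c'.2) ↔ V.Step c a c' := by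
  constructor
  · rintro ⟨t, ht, hta, hf⟩
    obtain ⟨t, ht', rfl⟩ := Finset.mem_map.1 ht
    exact ⟨t, ht', hta, e.injective hf.1, e.injective hf.2.1, hf.2.2⟩
  · rintro ⟨t, ht, hta, hf⟩
    exact ⟨_, Finset.mem_map_of_mem _ ht, hta, congrArg e hf.1, congrArg e hf.2.1, hf.2.2⟩

theorem rename_reads {c : VASSConfig k Q} {w : List α} :
    (V.rename e).Reads (e c.1, c.2) w ↔ V.Reads c w := by
  constructor
  · refine Reads.of_simulation (fun d c => d = (e c.1, c.2)) ?_ rfl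
    rintro _ c a ⟨d, u⟩ rfl hs
    obtain ⟨d, rfl⟩ := e.surjective d
    exact ⟨(d, u), rename_step.1 hs, rfl⟩
  · refine Reads.of_simulation (fun c d => d = (e c.1, c.2)) ?_ rfl
    rintro c _ a d rfl hs
    exact ⟨_, rename_step.2 hs, rfl⟩

theorem HasBestSuccessors.rename (h : V.HasBestSuccessors) :
    (V.rename e).HasBestSuccessors := by
  have surj : ∀ c : VASSConfig k R, ∃ c' : VASSConfig k Q, c = (e c'.1, c'.2) :=
    fun c => ⟨(e.symm c.1, c.2), by simp⟩
  rintro c a ⟨d, hd⟩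
  obtain ⟨c, rfl⟩ := surj c
  obtain ⟨d, rfl⟩ := surj d
  obtain ⟨d, hd, hbest⟩ := h c a ⟨d, rename_step.1 hd⟩
  refine ⟨_, rename_step.2 hd, fun d' hd' w hw => ?_⟩
  obtain ⟨d', rfl⟩ := surj d'
  exact rename_reads.2 (hbest d' (rename_step.1 hd') w (rename_reads.1 hw))

theorem IsDeterministic.rename (h : V.IsDeterministic) : (V.rename e).IsDeterministic := by
  intro t₁ h₁ t₂ h₂ hs hl
  obtain ⟨t₁, h₁', rfl⟩ := Finset.mem_map.1 h₁
  obtain ⟨t₂, h₂', rfl⟩ := Finset.mem_map.1 h₂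
  rw [h t₁ h₁' t₂ h₂' (e.injective hs) hl]

end Rename

/-- A description of a VASS. -/
noncomputable def code {m n : ℕ} (V : VASS k (Fin m) (Fin n)) : Code k :=
  (m, n, ((V.init.1 : ℕ), V.init.2), V.final.toList.map fun c => ((c.1 : ℕ), c.2),
    V.trans.toList.map fun t => ((t.src : ℕ), (t.letter : ℕ), t.effect, (t.tgt : ℕ)))

theorem isCode_code {m n : ℕ} (V : VASS k (Fin m) (Fin n)) : IsCode V.code V := by
  refine ⟨rfl, rfl, rfl, fun x => ?_, fun x => ?_⟩ <;> simp [code, eq_comm]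

end VASS

/-! ### The unchecked and the checking VASS -/

namespace CounterMachine

open VASS

variable {k : ℕ} {S : Type}

/-- The effect that adds `v`. -/
def addEffect (v : Fin k → ℕ) : Fin k → ℤ := fun i => v i

/-- The effect that decrements the counter `r` and adds `v`. -/
def decEffect (r : Fin k) (v : Fin k → ℕ) : Fin k → ℤ :=
  fun i => v i - (Pi.single r 1 : Fin k → ℤ) i

theorem fires_addEffect {Q : Type} {q q' s t : Q} {u u' v : Fin k → ℕ} {a : Fin 3} :
    Fires (q, u) ⟨s, a, addEffect v, t⟩ (q', u') ↔ q = s ∧ q' = t ∧ u' = u + v := by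
  refine and_congr_right fun _ => and_congr_right fun _ => ?_
  rw [funext_iff]
  refine forall_congr' fun i => ?_
  simp only [addEffect, Pi.add_apply]
  omega

/-- The condition `v r = 0` prevents the addition from compensating for the decrement, so that
firing really tests `u r ≠ 0`. -/
theorem fires_decEffect {Q : Type} {q q' s t : Q} {u u' v : Fin k → ℕ} {a : Fin 3} {r : Fin k}
    (hv : v r = 0) :
    Fires (q, u) ⟨s, a, decEffect r v, t⟩ (q', u') ↔
      q = s ∧ q' = t ∧ u r ≠ 0 ∧ u' = update u r (u r - 1) + v := by
  refine and_congr_right fun _ => and_congr_right fun _ => ?_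
  simp only [decEffect]
  constructor
  · intro h
    have hr := h r
    simp only [hv, Pi.single_eq_same] at hr
    refine ⟨by omega, funext fun i => ?_⟩
    have hi := h i
    by_cases hir : i = r
    · subst hir
      simp only [Pi.add_apply, update_self, hv]
      omega
    · simp only [Pi.single_eq_of_ne hir] at hi
      simp only [Pi.add_apply, update_of_ne hir]
      omega
  · rintro ⟨h, rfl⟩ i
    by_cases hir : i = r
    · subst hir
      simp only [Pi.add_apply, update_self, hv, Pi.single_eq_same]
      omega
    · simp only [Pi.add_apply, update_of_ne hir, Pi.single_eq_of_ne hir]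
      omega

theorem update_pred_add_single {u : Fin k → ℕ} {r : Fin k} (h : u r ≠ 0) :
    update u r (u r - 1) + Pi.single r 1 = u := by
  ext i
  by_cases hi : i = r
  · subst hi
    simp only [Pi.add_apply, update_self, Pi.single_eq_same]
    omega
  · simp [hi]

/-- The transitions that perform an instruction without checking that a counter is zero. Letter `1`
is read in the case of a positive counter, letter `0` twice otherwise. -/
def uncheckedTrans {Q : Type} (main mid : S → Q) (s : S) (I : CounterInstr (Fin k) S) :
    List (VASSTransition k (Fin 3) Q) :=
  [⟨main s, 1, decEffect I.reg I.posAdd, main I.posTgt⟩,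
    ⟨main s, 0, addEffect 0, mid s⟩,
    ⟨mid s, 0, addEffect I.zeroAdd, main I.zeroTgt⟩]

open Classical in
/-- The deterministic VASS that performs runs of a counter machine without checking that counters
are zero, and reads the letter `2` when the machine halts. In states `(true, s)`, the first letter
of a zero test has been read. -/
noncomputable def uncheckedVASS [Fintype S] (M : CounterMachine (Fin k) S) (s₀ : S)
    (u₀ : Fin k → ℕ) : VASS k (Fin 3) (Bool × S) where
  init := ((false, s₀), u₀)
  final := Finset.univ ×ˢ {0}
  trans := Finset.univ.biUnion fun s =>
    (show List (VASSTransition k (Fin 3) (Bool × S)) from match M.instr s with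
      | none => [⟨(false, s), 2, addEffect 0, (false, s)⟩]
      | some I => uncheckedTrans (Prod.mk false) (Prod.mk true) s I).toFinset

/-- The modes of the VASS that detects incorrect zero tests: in two copies of the unchecked VASS,
one for runs without a detected error and one for those with a detected error, and between the two
letters of an incorrect zero test. -/
inductive Mode
  | main (detected : Bool)
  | mid (detected : Bool)
  | detect

instance : Fintype Mode :=
  ⟨⟨([.main false, .main true, .mid false, .mid true, .detect] : List Mode), by simp⟩, fun m => by
    rcases m with (_ | _) | (_ | _) | _ <;> simp⟩

open Classical in
/-- The history-deterministic VASS that performs runs of a counter machine, where it can detect an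
incorrect zero test by decrementing the counter. It reads the letter `2` only after that. -/
noncomputable def checkingVASS [Fintype S] (M : CounterMachine (Fin k) S) (s₀ : S)
    (u₀ : Fin k → ℕ) : VASS k (Fin 3) (Mode × S) where
  init := ((.main false, s₀), u₀)
  final := Finset.univ ×ˢ {0}
  trans := Finset.univ.biUnion fun s =>
    (show List (VASSTransition k (Fin 3) (Mode × S)) from match M.instr s with
      | none => [⟨(.main true, s), 2, addEffect 0, (.main true, s)⟩]
      | some I =>
        uncheckedTrans (Prod.mk (.main false)) (Prod.mk (.mid false)) s I ++
          uncheckedTrans (Prod.mk (.main true)) (Prod.mk (.mid true)) s I ++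
          [⟨(.main false, s), 0, decEffect I.reg 0, (.detect, s)⟩,
            ⟨(.detect, s), 0, addEffect (Pi.single I.reg 1 + I.zeroAdd),
              (.main true, I.zeroTgt)⟩]).toFinset

/-- The steps of the unchecked VASS. -/
inductive UncheckedStep (M : CounterMachine (Fin k) S) :
    VASSConfig k (Bool × S) → Fin 3 → VASSConfig k (Bool × S) → Prop
  | halt {s u} (h : M.instr s = none) : UncheckedStep M ((false, s), u) 2 ((false, s), u)
  | pos {s u I} (h : M.instr s = some I) (hu : u I.reg ≠ 0) :
      UncheckedStep M ((false, s), u) 1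
        ((false, I.posTgt), update u I.reg (u I.reg - 1) + I.posAdd)
  | zero {s u I} (h : M.instr s = some I) : UncheckedStep M ((false, s), u) 0 ((true, s), u)
  | zero' {s u I} (h : M.instr s = some I) :
      UncheckedStep M ((true, s), u) 0 ((false, I.zeroTgt), u + I.zeroAdd)

/-- The steps of the checking VASS. -/
inductive CheckingStep (M : CounterMachine (Fin k) S) :
    VASSConfig k (Mode × S) → Fin 3 → VASSConfig k (Mode × S) → Prop
  | halt {s u} (h : M.instr s = none) :
      CheckingStep M ((.main true, s), u) 2 ((.main true, s), u)
  | pos {b s u I} (h : M.instr s = some I) (hu : u I.reg ≠ 0) :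
      CheckingStep M ((.main b, s), u) 1
        ((.main b, I.posTgt), update u I.reg (u I.reg - 1) + I.posAdd)
  | zero {b s u I} (h : M.instr s = some I) :
      CheckingStep M ((.main b, s), u) 0 ((.mid b, s), u)
  | zero' {b s u I} (h : M.instr s = some I) :
      CheckingStep M ((.mid b, s), u) 0 ((.main b, I.zeroTgt), u + I.zeroAdd)
  | detect {s u I} (h : M.instr s = some I) (hu : u I.reg ≠ 0) :
      CheckingStep M ((.main false, s), u) 0 ((.detect, s), update u I.reg (u I.reg - 1))
  | detect' {s u I} (h : M.instr s = some I) :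
      CheckingStep M ((.detect, s), u) 0
        ((.main true, I.zeroTgt), u + (Pi.single I.reg 1 + I.zeroAdd))

variable {M : CounterMachine (Fin k) S}

/-- A configuration of the checking VASS, with or without a detected error as specified by `P`,
represents a configuration of the unchecked VASS. -/
inductive Represents (M : CounterMachine (Fin k) S) (P : Bool → Prop) :
    VASSConfig k (Mode × S) → VASSConfig k (Bool × S) → Prop
  | main {b s u} (hb : P b) : Represents M P ((.main b, s), u) ((false, s), u)
  | mid {b s u} (hb : P b) : Represents M P ((.mid b, s), u) ((true, s), u)
  | detect {s u I} (h : M.instr s = some I) :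
      Represents M P ((.detect, s), u) ((true, s), u + Pi.single I.reg 1)

/-- Forgetting whether an error was detected maps checking runs to unchecked runs; between the two
letters of a detection, the borrowed unit of the counter is put back. -/
theorem Represents.step_unchecked {c : VASSConfig k (Mode × S)} {d : VASSConfig k (Bool × S)}
    {a : Fin 3} {c' : VASSConfig k (Mode × S)} (hr : Represents M (fun _ => True) c d)
    (hs : CheckingStep M c a c') :
    ∃ d', UncheckedStep M d a d' ∧ Represents M (fun _ => True) c' d' := by
  cases hs with
  | halt h => cases hr; exact ⟨_, .halt h, .main trivial⟩
  | pos h hu => cases hr; exact ⟨_, .pos h hu, .main trivial⟩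
  | zero h => cases hr; exact ⟨_, .zero h, .mid trivial⟩
  | zero' h => cases hr; exact ⟨_, .zero' h, .main trivial⟩
  | detect h hu =>
    cases hr
    refine ⟨_, .zero h, ?_⟩
    conv => arg 4; rw [← update_pred_add_single hu]
    exact .detect h
  | detect' h =>
    cases hr with
    | detect h' =>
      obtain rfl := Option.some.inj (h.symm.trans h')
      refine ⟨_, .zero' h, ?_⟩
      rw [add_assoc]
      exact .main trivial

/-- Once an error has been detected, or is being detected, the letter `2` is no longer withheld, so
every unchecked step can be matched. -/
theorem Represents.step_checking {c : VASSConfig k (Mode × S)} {d : VASSConfig k (Bool × S)}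
    {a : Fin 3} {d' : VASSConfig k (Bool × S)} (hr : Represents M (· = true) c d)
    (hs : UncheckedStep M d a d') :
    ∃ c', CheckingStep M c a c' ∧ Represents M (· = true) c' d' := by
  cases hr with
  | main hb =>
    subst hb
    cases hs with
    | halt h => exact ⟨_, .halt h, .main rfl⟩
    | pos h hu => exact ⟨_, .pos h hu, .main rfl⟩
    | zero h => exact ⟨_, .zero h, .mid rfl⟩
  | mid hb =>
    subst hb
    cases hs with
    | zero' h => exact ⟨_, .zero' h, .main rfl⟩
  | detect h =>
    cases hs with
    | zero' h' =>
      obtain rfl := Option.some.inj (h.symm.trans h')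
      refine ⟨_, .detect' h, ?_⟩
      rw [add_assoc]
      exact .main rfl

theorem eval_dom_of_step {c c' : S × (Fin k → ℕ)} (h : M.step c = some c') :
    (eval M.step c').Dom ↔ (eval M.step c).Dom := by
  rw [reaches_eval (Relation.ReflTransGen.single h)]

theorem step_of_eq_zero {s : S} {I} {u : Fin k → ℕ} (h : M.instr s = some I) (hu : u I.reg = 0) :
    M.step (s, u) = some (I.zeroTgt, u + I.zeroAdd) := by
  simp [step, h, hu]

theorem step_of_ne_zero {s : S} {I} {u : Fin k → ℕ} (h : M.instr s = some I) (hu : u I.reg ≠ 0) :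
    M.step (s, u) = some (I.posTgt, update u I.reg (u I.reg - 1) + I.posAdd) := by
  simp [step, h, hu]

/-- The relation between configurations of the unchecked and of the checking VASS in runs of a
counter machine that does not halt. -/
inductive RepresentsDivergent (M : CounterMachine (Fin k) S) :
    VASSConfig k (Bool × S) → VASSConfig k (Mode × S) → Prop
  | detected {c d} (h : Represents M (· = true) d c) : RepresentsDivergent M c d
  | main {s u} (h : ¬ (eval M.step (s, u)).Dom) :
      RepresentsDivergent M ((false, s), u) ((.main false, s), u)
  | mid {s u I} (hI : M.instr s = some I)
      (h : ¬ (eval M.step (I.zeroTgt, u + I.zeroAdd)).Dom) :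
      RepresentsDivergent M ((true, s), u) ((.mid false, s), u)

variable [Fintype S] {s₀ : S} {u₀ : Fin k → ℕ}

theorem uncheckedVASS_mem_trans {t : VASSTransition k (Fin 3) (Bool × S)} :
    t ∈ (M.uncheckedVASS s₀ u₀).trans ↔
      (∃ s, M.instr s = none ∧ t = ⟨(false, s), 2, addEffect 0, (false, s)⟩) ∨
      ∃ s I, M.instr s = some I ∧ t ∈ uncheckedTrans (Prod.mk false) (Prod.mk true) s I := by
  simp only [uncheckedVASS, Finset.mem_biUnion, Finset.mem_univ, true_and, List.mem_toFinset]
  constructor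
  · rintro ⟨s, hs⟩
    cases h : M.instr s with
    | none => exact .inl ⟨s, h, by simpa [h] using hs⟩
    | some I => exact .inr ⟨s, I, h, by simpa [h] using hs⟩
  · rintro (⟨s, h, ht⟩ | ⟨s, I, h, ht⟩) <;> exact ⟨s, by simpa [h] using ht⟩

theorem checkingVASS_mem_trans {t : VASSTransition k (Fin 3) (Mode × S)} :
    t ∈ (M.checkingVASS s₀ u₀).trans ↔
      (∃ s, M.instr s = none ∧ t = ⟨(.main true, s), 2, addEffect 0, (.main true, s)⟩) ∨
      ∃ s I, M.instr s = some I ∧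
        ((∃ b, t ∈ uncheckedTrans (Prod.mk (.main b)) (Prod.mk (.mid b)) s I) ∨
          t = ⟨(.main false, s), 0, decEffect I.reg 0, (.detect, s)⟩ ∨
          t = ⟨(.detect, s), 0, addEffect (Pi.single I.reg 1 + I.zeroAdd),
              (.main true, I.zeroTgt)⟩) := by
  simp only [checkingVASS, Finset.mem_biUnion, Finset.mem_univ, true_and, List.mem_toFinset]
  constructor
  · rintro ⟨s, hs⟩
    cases h : M.instr s with
    | none => exact .inl ⟨s, h, by simpa [h] using hs⟩
    | some I => exact .inr ⟨s, I, h, by simpa [h, or_assoc] using hs⟩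
  · rintro (⟨s, h, ht⟩ | ⟨s, I, h, ht⟩) <;> exact ⟨s, by simpa [h, or_assoc] using ht⟩

theorem uncheckedVASS_step {c c' : VASSConfig k (Bool × S)} {a : Fin 3} :
    (M.uncheckedVASS s₀ u₀).Step c a c' ↔ UncheckedStep M c a c' := by
  constructor
  · obtain ⟨q, u⟩ := c
    obtain ⟨q', u'⟩ := c'
    rintro ⟨t, ht, rfl, hf⟩
    rcases uncheckedVASS_mem_trans.1 ht with ⟨s, h, rfl⟩ | ⟨s, I, h, ht⟩
    · obtain ⟨rfl, rfl, rfl⟩ := fires_addEffect.1 hf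
      exact .halt h
    · simp only [uncheckedTrans, List.mem_cons, List.not_mem_nil, or_false] at ht
      rcases ht with rfl | rfl | rfl
      · obtain ⟨rfl, rfl, hu, rfl⟩ := (fires_decEffect I.posAdd_reg).1 hf
        exact .pos h hu
      · obtain ⟨rfl, rfl, rfl⟩ := fires_addEffect.1 hf
        exact .zero h
      · obtain ⟨rfl, rfl, rfl⟩ := fires_addEffect.1 hf
        exact .zero' h
  · intro h
    cases h with
    | halt h =>
      exact ⟨_, uncheckedVASS_mem_trans.2 (.inl ⟨_, h, rfl⟩), rfl,
        fires_addEffect.2 ⟨rfl, rfl, rfl⟩⟩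
    | pos h hu =>
      exact ⟨_, uncheckedVASS_mem_trans.2 (.inr ⟨_, _, h, .head _⟩), rfl,
        (fires_decEffect (CounterInstr.posAdd_reg _)).2 ⟨rfl, rfl, hu, rfl⟩⟩
    | zero h =>
      exact ⟨_, uncheckedVASS_mem_trans.2 (.inr ⟨_, _, h, .tail _ (.head _)⟩), rfl,
        fires_addEffect.2 ⟨rfl, rfl, rfl⟩⟩
    | zero' h =>
      exact ⟨_, uncheckedVASS_mem_trans.2 (.inr ⟨_, _, h, .tail _ (.tail _ (.head _))⟩), rfl,
        fires_addEffect.2 ⟨rfl, rfl, rfl⟩⟩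

theorem checkingVASS_step {c c' : VASSConfig k (Mode × S)} {a : Fin 3} :
    (M.checkingVASS s₀ u₀).Step c a c' ↔ CheckingStep M c a c' := by
  constructor
  · obtain ⟨q, u⟩ := c
    obtain ⟨q', u'⟩ := c'
    rintro ⟨t, ht, rfl, hf⟩
    rcases checkingVASS_mem_trans.1 ht with ⟨s, h, rfl⟩ | ⟨s, I, h, ⟨b, ht⟩ | rfl | rfl⟩
    · obtain ⟨rfl, rfl, rfl⟩ := fires_addEffect.1 hf
      exact .halt h
    · simp only [uncheckedTrans, List.mem_cons, List.not_mem_nil, or_false] at ht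
      rcases ht with rfl | rfl | rfl
      · obtain ⟨rfl, rfl, hu, rfl⟩ := (fires_decEffect I.posAdd_reg).1 hf
        exact .pos h hu
      · obtain ⟨rfl, rfl, rfl⟩ := fires_addEffect.1 hf
        exact .zero h
      · obtain ⟨rfl, rfl, rfl⟩ := fires_addEffect.1 hf
        exact .zero' h
    · obtain ⟨rfl, rfl, hu, rfl⟩ := (fires_decEffect rfl).1 hf
      exact .detect h hu
    · obtain ⟨rfl, rfl, rfl⟩ := fires_addEffect.1 hf
      exact .detect' h
  · intro h
    cases h with
    | halt h =>
      exact ⟨_, checkingVASS_mem_trans.2 (.inl ⟨_, h, rfl⟩), rfl,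
        fires_addEffect.2 ⟨rfl, rfl, rfl⟩⟩
    | pos h hu =>
      exact ⟨_, checkingVASS_mem_trans.2 (.inr ⟨_, _, h, .inl ⟨_, .head _⟩⟩), rfl,
        (fires_decEffect (CounterInstr.posAdd_reg _)).2 ⟨rfl, rfl, hu, rfl⟩⟩
    | zero h =>
      exact ⟨_, checkingVASS_mem_trans.2 (.inr ⟨_, _, h, .inl ⟨_, .tail _ (.head _)⟩⟩), rfl,
        fires_addEffect.2 ⟨rfl, rfl, rfl⟩⟩
    | zero' h =>
      exact ⟨_, checkingVASS_mem_trans.2 (.inr ⟨_, _, h, .inl ⟨_, .tail _ (.tail _ (.head _))⟩⟩),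
        rfl, fires_addEffect.2 ⟨rfl, rfl, rfl⟩⟩
    | detect h hu =>
      exact ⟨_, checkingVASS_mem_trans.2 (.inr ⟨_, _, h, .inr (.inl rfl)⟩), rfl,
        (fires_decEffect rfl).2 ⟨rfl, rfl, hu, rfl⟩⟩
    | detect' h =>
      exact ⟨_, checkingVASS_mem_trans.2 (.inr ⟨_, _, h, .inr (.inr rfl)⟩), rfl,
        fires_addEffect.2 ⟨rfl, rfl, rfl⟩⟩

theorem uncheckedVASS_isDeterministic : (M.uncheckedVASS s₀ u₀).IsDeterministic := by
  intro t₁ h₁ t₂ h₂ hs hl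
  rw [uncheckedVASS_mem_trans] at h₁ h₂
  simp only [uncheckedTrans, List.mem_cons, List.not_mem_nil, or_false] at h₁ h₂
  rcases h₁ with ⟨s, h, rfl⟩ | ⟨s, I, h, rfl | rfl | rfl⟩ <;>
  rcases h₂ with ⟨s', h', rfl⟩ | ⟨s', I', h', rfl | rfl | rfl⟩ <;>
  simp_all

theorem Represents.reads_unchecked {c : VASSConfig k (Mode × S)} {d : VASSConfig k (Bool × S)}
    (h : Represents M (fun _ => True) c d) {w : List (Fin 3)}
    (hw : (M.checkingVASS s₀ u₀).Reads c w) : (M.uncheckedVASS s₀ u₀).Reads d w :=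
  Reads.of_simulation _ (fun _ _ _ _ hr hs => by
    obtain ⟨d', h, h'⟩ := hr.step_unchecked (checkingVASS_step.1 hs)
    exact ⟨d', uncheckedVASS_step.2 h, h'⟩) h hw

theorem Represents.reads_checking {c : VASSConfig k (Mode × S)} {d : VASSConfig k (Bool × S)}
    (h : Represents M (· = true) c d) {w : List (Fin 3)}
    (hw : (M.uncheckedVASS s₀ u₀).Reads d w) : (M.checkingVASS s₀ u₀).Reads c w :=
  Reads.of_simulation (fun d c => Represents M (· = true) c d) (fun _ _ _ _ hr hs => by
    obtain ⟨d', h, h'⟩ := hr.step_checking (uncheckedVASS_step.1 hs)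
    exact ⟨d', checkingVASS_step.2 h, h'⟩) h hw

/-- A detecting successor reads all that the unchecked VASS reads from the configuration it
represents, and a competing successor represents the same configuration and so reads no more. Where
no detection is possible the step is unique. -/
theorem checkingVASS_hasBestSuccessors : (M.checkingVASS s₀ u₀).HasBestSuccessors := by
  simp only [HasBestSuccessors, checkingVASS_step]
  rintro c a ⟨d, hd⟩
  by_cases hc : ∃ d, CheckingStep M c a d ∧ d.1.1 = .detect
  · obtain ⟨d, hd, hdet⟩ := hc
    refine ⟨d, hd, fun d' hd' w hw => ?_⟩
    cases hd with
    | @detect s u I h hu =>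
      cases hd' with
      | zero h' =>
        have hr : Represents M (· = true) 
            ((.detect, s), update u I.reg (u I.reg - 1)) _ := .detect h
        rw [update_pred_add_single hu] at hr
        exact hr.reads_checking ((Represents.mid trivial).reads_unchecked hw)
      | detect h' hu' =>
        obtain rfl := Option.some.inj (h.symm.trans h')
        exact hw
    | _ => cases hdet
  · refine ⟨d, hd, fun d' hd' w hw => ?_⟩
    suffices d' = d from this ▸ hw
    cases hd with
    | detect h hu => exact (hc ⟨_, .detect h hu, rfl⟩).elim
    | _ => cases hd' <;> first | exact (hc ⟨_, .detect ‹_› ‹_›, rfl⟩).elim | simp_all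

/-- Until the first error the unchecked run follows the divergent computation, so `2` cannot occur;
at the first error the checking VASS detects. -/
theorem reads_checking_of_not_dom {s : S} {u : Fin k → ℕ} (h : ¬ (eval M.step (s, u)).Dom)
    {w : List (Fin 3)} (hw : (M.uncheckedVASS s₀ u₀).Reads ((false, s), u) w) :
    (M.checkingVASS s₀ u₀).Reads ((.main false, s), u) w := by
  refine Reads.of_simulation (RepresentsDivergent M) (fun c d a c' hr hs => ?_) (.main h) hw
  simp only [checkingVASS_step]
  rw [uncheckedVASS_step] at hs
  cases hr with
  | detected hr =>
    obtain ⟨d', h, h'⟩ := hr.step_checking hs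
    exact ⟨d', h, .detected h'⟩
  | @main s u hd =>
    cases hs with
    | halt h =>
      refine (hd ?_).elim
      rw [Part.dom_iff_mem]
      exact ⟨(s, u), mem_eval.2 ⟨.refl, by simp [step, h]⟩⟩
    | pos h hu =>
      exact ⟨_, .pos h hu, .main (by rwa [eval_dom_of_step (step_of_ne_zero h hu)])⟩
    | @zero _ _ I h =>
      by_cases hu : u I.reg = 0
      · exact ⟨_, .zero h, .mid h (by rwa [eval_dom_of_step (step_of_eq_zero h hu)])⟩
      -- The first incorrect zero test: the simulation switches to the detected copy.
      · have hr : Represents M (· = true) ((.detect, s), update u I.reg (u I.reg - 1)) _ :=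
          .detect h
        rw [update_pred_add_single hu] at hr
        exact ⟨_, .detect h hu, .detected hr⟩
  | mid hI hd =>
    cases hs with
    | zero' h =>
      obtain rfl := Option.some.inj (h.symm.trans hI)
      exact ⟨_, .zero' h, .main hd⟩

/-- The witness is the word of the true computation followed by `2`. Along it every zero branch is
taken with an empty counter, so detection never fires and `2` stays blocked. -/
theorem exists_reads_unchecked_of_dom {c : S × (Fin k → ℕ)} (h : (eval M.step c).Dom) :
    ∃ w, (M.uncheckedVASS s₀ u₀).Reads ((false, c.1), c.2) w ∧
      ¬ (M.checkingVASS s₀ u₀).Reads ((.main false, c.1), c.2) w := by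
  obtain ⟨b, hb⟩ := Part.dom_iff_mem.1 h
  obtain ⟨hr, hb'⟩ := mem_eval.1 hb
  clear h hb
  induction hr using Relation.ReflTransGen.head_induction_on with
  | refl =>
    obtain ⟨s, u⟩ := b
    have h : M.instr s = none := by simpa [step] using hb'
    refine ⟨[2], ⟨_, uncheckedVASS_step.2 (.halt h), trivial⟩, ?_⟩
    rintro ⟨d, hd, -⟩
    cases checkingVASS_step.1 hd
  | @head c c' hs _ ih =>
    obtain ⟨s, u⟩ := c
    obtain ⟨w, hw, hw'⟩ := ih
    cases h : M.instr s with
    | none => simp [step, h] at hs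
    | some I =>
      by_cases hu : u I.reg = 0
      · obtain rfl := Option.some.inj ((step_of_eq_zero h hu).symm.trans hs)
        refine ⟨0 :: 0 :: w, ⟨_, uncheckedVASS_step.2 (.zero h), _,
          uncheckedVASS_step.2 (.zero' h), hw⟩, ?_⟩
        rintro ⟨d, hd, d', hd', hr⟩
        cases checkingVASS_step.1 hd with
        | zero =>
          cases checkingVASS_step.1 hd' with
          | zero' h' =>
            obtain rfl := Option.some.inj (h.symm.trans h')
            exact hw' hr
        | detect h' hu' =>
          obtain rfl := Option.some.inj (h.symm.trans h')
          exact hu' hu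
      · obtain rfl := Option.some.inj ((step_of_ne_zero h hu).symm.trans hs)
        refine ⟨1 :: w, ⟨_, uncheckedVASS_step.2 (.pos h hu), hw⟩, ?_⟩
        rintro ⟨d, hd, hr⟩
        cases checkingVASS_step.1 hd with
        | pos h' =>
          obtain rfl := Option.some.inj (h.symm.trans h')
          exact hw' hr

theorem forall_reads_iff_not_dom :
    (∀ w, (M.uncheckedVASS s₀ u₀).Reads ((false, s₀), u₀) w ↔
      (M.checkingVASS s₀ u₀).Reads ((.main false, s₀), u₀) w) ↔
    ¬ (eval M.step (s₀, u₀)).Dom := by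
  constructor
  · intro h hd
    obtain ⟨w, hw, hw'⟩ := exists_reads_unchecked_of_dom (s₀ := s₀) (u₀ := u₀) hd
    exact hw' ((h w).1 hw)
  · exact fun h w => ⟨reads_checking_of_not_dom h, (Represents.main trivial).reads_unchecked⟩

end CounterMachine

/-! ### The reduction from the halting problem -/

theorem primrec_vecCons_zero {g : ℕ → ℕ} (hg : Primrec g) :
    Primrec fun n => (![g n, 0] : Fin 2 → ℕ) := by
  refine Primrec.fin_curry.2 ((Primrec.ite (Primrec.eq.comp Primrec.snd (Primrec.const 0))
    (hg.comp Primrec.fst) (Primrec.const 0)).of_eq ?_)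
  rintro ⟨n, i⟩
  fin_cases i <;> rfl

theorem theorem1 :
    ¬ ∃ f : VASS.Code 2 × VASS.Code 2 →. Bool, Partrec f ∧
      ∀ (m n₁ n₂ : ℕ) (A : VASS 2 (Fin m) (Fin n₁)) (B : VASS 2 (Fin m) (Fin n₂)),
        A.HasTraceAcceptance → B.HasTraceAcceptance →
        A.IsDeterministic → B.IsHistoryDeterministic →
        ∀ a b : VASS.Code 2, VASS.IsCode a A → VASS.IsCode b B →
          ∃ r ∈ f (a, b), (r = true ↔ A.traceLanguage = B.traceLanguage) := by
  rintro ⟨f, hf, hfc⟩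
  have hh : Partrec fun n : ℕ => (Denumerable.ofNat Nat.Partrec.Code n).eval 0 :=
    Nat.Partrec.Code.eval_part.comp (Computable.ofNat _) (Computable.const 0)
  obtain ⟨S, _, M, s, g, hg, hM⟩ := exists_counterMachine_eval_dom hh
  have := Fintype.ofFinite S
  let eA := Fintype.equivFin (Bool × S)
  let eB := Fintype.equivFin (CounterMachine.Mode × S)
  let A : ℕ → VASS 2 (Fin 3) (Fin _) := fun n => (M.uncheckedVASS s ![g n, 0]).rename eA
  let B : ℕ → VASS 2 (Fin 3) (Fin _) := fun n => (M.checkingVASS s ![g n, 0]).rename eB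
  have hA : ∀ n, (A n).HasTraceAcceptance := fun n =>
    VASS.HasTraceAcceptance.rename (by simp [VASS.HasTraceAcceptance, CounterMachine.uncheckedVASS])
  have hB : ∀ n, (B n).HasTraceAcceptance := fun n =>
    VASS.HasTraceAcceptance.rename (by simp [VASS.HasTraceAcceptance, CounterMachine.checkingVASS])
  have hlang : ∀ n, (A n).traceLanguage = (B n).traceLanguage ↔
      ¬ ((Denumerable.ofNat Nat.Partrec.Code n).eval 0).Dom := by
    intro n
    rw [← hM n, ← CounterMachine.forall_reads_iff_not_dom]
    refine Set.ext_iff.trans (forall_congr' fun w => ?_)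
    exact iff_congr ((hA n).mem_traceLanguage.trans VASS.rename_reads)
      ((hB n).mem_traceLanguage.trans VASS.rename_reads)
  -- The machine is fixed and `n` enters only through the initial counters. The lists of final
  -- configurations and transitions are therefore constant and can be taken from `A 0` and `B 0`,
  -- although they are chosen noncomputably.
  have hcode : Computable fun n => ((A n).code, (B n).code) := by
    have hv := Computable.pair (Computable.const (σ := ℕ) (eA (false, s)).val)
      (primrec_vecCons_zero hg).to_comp
    have hv' := Computable.pair (Computable.const (σ := ℕ) (eB (.main false, s)).val)
      (primrec_vecCons_zero hg).to_comp
    exact Computable.pair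
      (.pair (.const 3) (.pair (.const _) (.pair hv (.const (A 0).code.2.2.2))))
      (.pair (.const 3) (.pair (.const _) (.pair hv' (.const (B 0).code.2.2.2))))
  have hdec : ∀ n, ∃ r ∈ f ((A n).code, (B n).code),
      (r = true ↔ (A n).traceLanguage = (B n).traceLanguage) := fun n =>
    hfc 3 _ _ (A n) (B n) (hA n) (hB n) CounterMachine.uncheckedVASS_isDeterministic.rename
      ((hB n).isHistoryDeterministic CounterMachine.checkingVASS_hasBestSuccessors.rename) _ _
      (VASS.isCode_code _) (VASS.isCode_code _)
  choose r hr hr' using hdec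
  -- All instances produced satisfy the promise, so the partial `f` is total along the reduction.
  have hrc : Computable r := (hf.comp hcode).of_eq_tot hr
  refine ComputablePred.halting_problem 0 (ComputablePred.computable_iff.2
    ⟨fun c => !r (Encodable.encode c),
      (Primrec.not.to_comp.comp (hrc.comp Computable.encode)), ?_⟩)
  ext c
  have h := (hr' (Encodable.encode c)).trans (hlang _)
  rw [Denumerable.ofNat_encode] at h
  cases hb : r (Encodable.encode c) <;> simp_all
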